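/- Vectors $v_1,\dots,v_m\in\mathbb{Z}^n$ are called Farkas-related if for all integers $a_1\le b_1,\dots,a_m\le b_m$ the following holds: whenever a vector $w\in\sum_{i=1}^m\mathbb{Z}v_i$ can be written as $w=\sum_{i=1}^m x_iv_i$ with rational numbers $a_i\le x_i\le b_i$ ($i=1,\dots,m$), it can also be written as $w=\sum_{i=1}^m y_iv_i$ with integers $a_i\le y_i\le b_i$ ($i=1,\dots,m$). An integral matrix is called a Farkas matrix if its columns are Farkas-related. The (unsigned) incidence matrix of a finite simple graph $G$ with vertices $1,\dots,n$ and edges $e_1,\dots,e_m$ is the $n\times m$ matrix $M$ with $M_{ij}=1$ if the vertex $i$ is an end of the edge $e_j$, and $M_{ij}=0$ otherwise. **Proposition.** The incidence matrix of a finite simple graph $G$ is a Farkas matrix if and only if $G$ does not contain two vertex-disjoint cycles of odd length that are connected by a path in $G$ (a path from a vertex of one cycle to a vertex of the other). -/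

import Mathlib

/-- Integral vectors `v i` (`i : ι`, a finite family) are Farkas-related: for all integer bounds
`a i ≤ b i`, every `w` in the `ℤ`-span of the family that is a combination of the `v i` with
rational coefficients in the intervals `[a i, b i]` is a combination of the `v i` with integer
coefficients in the same intervals. -/
def FarkasRelated {ι κ : Type*} [Fintype ι] (v : ι → κ → ℤ) : Prop :=
  ∀ a b : ι → ℤ, (∀ i, a i ≤ b i) →
    ∀ w ∈ Submodule.span ℤ (Set.range v),
      (∃ x : ι → ℚ, (∀ i, (a i : ℚ) ≤ x i ∧ x i ≤ (b i : ℚ)) ∧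
        ∀ k, (w k : ℚ) = ∑ i, x i * (v i k : ℚ)) →
      ∃ y : ι → ℤ, (∀ i, a i ≤ y i ∧ y i ≤ b i) ∧ w = ∑ i, y i • v i

/-- A Farkas matrix: an integral matrix whose columns are Farkas-related. -/
def Matrix.IsFarkas {κ ι : Type*} [Fintype ι] (A : Matrix κ ι ℤ) : Prop :=
  FarkasRelated fun j => A.col j

/-- The (unsigned) incidence matrix of `G`, with one row for each vertex and one column for each
edge. Mathlib's `SimpleGraph.incMatrix` also has a zero column for every non-edge. -/
def SimpleGraph.edgeIncMatrix {V : Type*} [DecidableEq V] (G : SimpleGraph V)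
    [DecidableRel G.Adj] :
    Matrix V G.edgeSet ℤ :=
  (G.incMatrix ℤ).submatrix id Subtype.val

/-- `G` contains two vertex-disjoint cycles `c`, `d` of odd length, and a path from a vertex of `c`
to a vertex of `d`. (A cycle may be based at any of its vertices, so it is no restriction to base
`c` and `d` at the two ends of the path.) -/
def SimpleGraph.HasPathConnectedOddCycles {V : Type*} (G : SimpleGraph V) : Prop :=
  ∃ (s t : V) (c : G.Walk s s) (d : G.Walk t t) (p : G.Walk s t),
    c.IsCycle ∧ Odd c.length ∧ d.IsCycle ∧ Odd d.length ∧
      c.support.Disjoint d.support ∧ p.IsPath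

/-!
After translation by an integer representation of `w`, the Farkas property says that every rational
kernel vector can be rounded, coordinatewise up or down, to an integer kernel vector. Moving along
kernel vectors supported on the fractional coordinates until a coordinate becomes integral, one may
assume that the columns at the fractional coordinates are linearly independent.

For an incidence matrix, let `F` be the graph of the fractional edges of such a kernel vector. The
fractional parts have an integral sum at each vertex `v` of `F`, strictly between `0` and `deg v`,
so `deg v ≥ 2`; independence gives `|E(F)| ≤ |V(F)|`. Hence `F` is a disjoint union of cycles and
all these sums are `1`. The cycles are odd, since the alternating vector of an even cycle is in the
kernel. By parity of the sum over a component of `G`, each component contains an even number of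
vertices of `F`, hence a second odd cycle as soon as it contains one.

Conversely, for odd cycles `c`, `d` joined by a path `p`, half the alternating vectors of `c` and
`d` (with a suitable sign) minus that of `p` is a kernel vector. Adding the alternating vector of
`p` to a rounding of it gives an integer vector supported on the edges of `c` and `d`, whose vertex
sums total `1` over the vertices of `c`; but this total counts every edge of `c` twice.
-/

open Matrix SimpleGraph

section BasicSolution

variable {K : Type*} [Field K] [LinearOrder K] [IsStrictOrderedRing K] [FloorRing K]

theorem exists_fract_add_mul_eq_zero (x : K) {k : K} (hk : k ≠ 0) :
    ∃ τ, 0 ≤ τ ∧ Int.fract (x + τ * k) = 0 ∧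
      ∀ t, 0 ≤ t → t ≤ τ → ⌊x⌋ ≤ x + t * k ∧ x + t * k ≤ ⌈x⌉ := by
  have hfloor := Int.floor_le x
  have hceil := Int.le_ceil x
  rcases hk.lt_or_gt with hk | hk
  · refine ⟨(⌊x⌋ - x) / k, div_nonneg_of_nonpos (by linarith) hk.le, ?_, fun t ht htτ => ?_⟩
    · simp [div_mul_cancel₀ _ hk.ne]
    · rw [le_div_iff_of_neg hk] at htτ
      have := mul_nonpos_of_nonneg_of_nonpos ht hk.le
      constructor <;> linarith
  · refine ⟨(⌈x⌉ - x) / k, div_nonneg (by linarith) hk.le, ?_, fun t ht htτ => ?_⟩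
    · simp [div_mul_cancel₀ _ hk.ne']
    · rw [le_div_iff₀ hk] at htτ
      have := mul_nonneg ht hk.le
      constructor <;> linarith

variable {ι M : Type*}

theorem exists_fract_add_smul_eq_zero [Finite ι] (x : ι → K) {k : ι → K} (hk : k ≠ 0) :
    ∃ t : K, (∀ i, ⌊x i⌋ ≤ (x + t • k) i ∧ (x + t • k) i ≤ ⌈x i⌉) ∧
      ∃ i, k i ≠ 0 ∧ Int.fract ((x + t • k) i) = 0 := by
  choose! τ hτ_nonneg hτ_fract hτ using
    fun i (hi : k i ≠ 0) => exists_fract_add_mul_eq_zero (x i) hi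
  obtain ⟨i, hi, hmin⟩ :=
    Set.exists_min_image {i | k i ≠ 0} τ (Set.toFinite _) (Function.ne_iff.1 hk)
  refine ⟨τ i, fun j => ?_, i, hi, hτ_fract i hi⟩
  by_cases hj : k j = 0
  · simp [hj, Int.floor_le, Int.le_ceil]
  · exact hτ j hj _ (hτ_nonneg i hi) (hmin j hj)

theorem exists_sum_smul_eq_zero_of_not_linearIndepOn {R : Type*} [Ring R] [AddCommGroup M]
    [Module R M] [Fintype ι] {v : ι → M} {s : Set ι} (h : ¬ LinearIndepOn R v s) :
    ∃ k : ι → R, k ≠ 0 ∧ (∀ i ∉ s, k i = 0) ∧ ∑ i, k i • v i = 0 := by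
  simp only [linearIndepOn_iff, not_forall] at h
  obtain ⟨k, hks, hk_sum, hk⟩ := h
  refine ⟨k, fun h => hk (DFunLike.coe_injective h), fun i hi => ?_, ?_⟩
  · exact Finsupp.notMem_support_iff.1 fun h => hi (hks h)
  · simpa [Finsupp.linearCombination_apply, Finsupp.sum_fintype] using hk_sum

theorem exists_linearIndepOn_fract_ne_zero [Fintype ι] [AddCommGroup M] [Module K M] (v : ι → M)
    (x : ι → K) :
    ∃ y : ι → K, (∀ i, ⌊x i⌋ ≤ y i ∧ y i ≤ ⌈x i⌉) ∧ ∑ i, y i • v i = ∑ i, x i • v i ∧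
      LinearIndepOn K v {i | Int.fract (y i) ≠ 0} := by
  induction hn : {i | Int.fract (x i) ≠ 0}.ncard using Nat.strong_induction_on generalizing x with
  | _ n ih =>
  by_cases hindep : LinearIndepOn K v {i | Int.fract (x i) ≠ 0}
  · exact ⟨x, fun i => ⟨Int.floor_le _, Int.le_ceil _⟩, rfl, hindep⟩
  obtain ⟨k, hk, hk_fract, hk_sum⟩ := exists_sum_smul_eq_zero_of_not_linearIndepOn hindep
  simp only [Set.mem_ofPred_eq, not_not] at hk_fract
  obtain ⟨t, ht, i, hki, hi⟩ := exists_fract_add_smul_eq_zero x hk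
  have hfewer : {i | Int.fract ((x + t • k) i) ≠ 0}.ncard < n := by
    rw [← hn]
    refine Set.ncard_lt_ncard ⟨fun j => mt fun hj => ?_, fun h => h (mt (hk_fract i) hki) hi⟩
    simp [hk_fract j hj, hj]
  obtain ⟨y, hy, hy_sum, hy_indep⟩ := ih _ hfewer (x + t • k) rfl
  refine ⟨y, fun i => ⟨?_, ?_⟩, ?_, hy_indep⟩
  · exact le_trans (by exact_mod_cast Int.le_floor.2 (ht i).1) (hy i).1
  · exact (hy i).2.trans (by exact_mod_cast Int.ceil_le.2 (ht i).2)
  · simp only [hy_sum, Pi.add_apply, Pi.smul_apply, smul_eq_mul, add_smul, mul_smul,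
      Finset.sum_add_distrib, ← Finset.smul_sum, hk_sum, smul_zero, add_zero]

end BasicSolution

section Farkas

variable {κ ι : Type*}

theorem mulVec_eq_sum_smul_col {R : Type*} [Fintype ι] [CommSemiring R] (A : Matrix κ ι R)
    (x : ι → R) : A *ᵥ x = ∑ i, x i • A.col i := by
  ext k
  simp [mulVec, dotProduct, mul_comm]

theorem map_intCast_mulVec {R : Type*} [Ring R] [Fintype ι] (A : Matrix κ ι ℤ) (z : ι → ℤ) :
    A.map (Int.cast : ℤ → R) *ᵥ (fun i => (z i : R)) = fun k => ((A *ᵥ z) k : R) :=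
  funext fun k => ((Int.castRingHom R).map_mulVec A z k).symm

variable [Fintype ι] {A : Matrix κ ι ℤ}

theorem isFarkas_iff_forall_mulVec_eq_zero :
    A.IsFarkas ↔ ∀ x : ι → ℚ, A.map (Int.cast : ℤ → ℚ) *ᵥ x = 0 →
      ∃ y : ι → ℤ, (∀ i, ⌊x i⌋ ≤ y i ∧ y i ≤ ⌈x i⌉) ∧ A *ᵥ y = 0 := by
  have mulVec_rat_apply (x : ι → ℚ) (k : κ) :
      (A.map (Int.cast : ℤ → ℚ) *ᵥ x) k = ∑ i, x i * (A.col i k : ℚ) := by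
    simp [mulVec_eq_sum_smul_col]
  constructor
  · intro h x hx
    obtain ⟨y, hy, hAy⟩ := h _ _ (fun i => Int.floor_le_ceil (x i)) 0 (zero_mem _)
      ⟨x, fun i => ⟨Int.floor_le _, Int.le_ceil _⟩, fun k => by
        rw [← mulVec_rat_apply, hx, Pi.zero_apply, Pi.zero_apply, Int.cast_zero]⟩
    exact ⟨y, hy, (mulVec_eq_sum_smul_col A y).trans hAy.symm⟩
  · rintro h a b - w hw ⟨x, hx, hwx⟩
    obtain ⟨z, rfl⟩ := (Submodule.mem_span_range_iff_exists_fun ℤ).1 hw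
    rw [← mulVec_eq_sum_smul_col] at hwx ⊢
    have hker : A.map (Int.cast : ℤ → ℚ) *ᵥ (x - fun i => (z i : ℚ)) = 0 := by
      rw [mulVec_sub, map_intCast_mulVec, sub_eq_zero]
      exact funext fun k => (mulVec_rat_apply x k).trans (hwx k).symm
    obtain ⟨y, hy, hAy⟩ := h _ hker
    simp only [Pi.sub_apply, Int.floor_sub_intCast, Int.ceil_sub_intCast] at hy
    refine ⟨y + z, fun i => ⟨?_, ?_⟩, ?_⟩
    · exact (Int.le_floor.2 (hx i).1).trans (sub_le_iff_le_add.1 (hy i).1)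
    · exact (le_sub_iff_add_le.1 (hy i).2).trans (Int.ceil_le.2 (hx i).2)
    · rw [← mulVec_eq_sum_smul_col, mulVec_add, hAy, zero_add]

theorem isFarkas_of_forall_linearIndepOn
    (h : ∀ x : ι → ℚ, A.map (Int.cast : ℤ → ℚ) *ᵥ x = 0 →
      LinearIndepOn ℚ (A.map (Int.cast : ℤ → ℚ)).col {i | Int.fract (x i) ≠ 0} →
        ∀ i, Int.fract (x i) = 0) :
    A.IsFarkas := by
  refine isFarkas_iff_forall_mulVec_eq_zero.2 fun x hx => ?_
  obtain ⟨x', hx', hsum, hindep⟩ :=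
    exists_linearIndepOn_fract_ne_zero (A.map (Int.cast : ℤ → ℚ)).col x
  rw [← mulVec_eq_sum_smul_col, ← mulVec_eq_sum_smul_col, hx] at hsum
  have hint (i) : ∃ n : ℤ, (n : ℚ) = x' i := Int.fract_eq_zero_iff.1 (h x' hsum hindep i)
  choose y hy using hint
  refine ⟨y, fun i => ?_, funext fun k => ?_⟩
  · exact_mod_cast (hy i).symm ▸ hx' i
  · rw [← funext hy, map_intCast_mulVec] at hsum
    exact Int.cast_eq_zero.1 (congrFun hsum k)

theorem card_le_card_of_linearIndependent_col {K : Type*} [Field K] [Finite κ]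
    {M : Matrix κ ι K} (hM : LinearIndependent K M.col) {S : Finset κ}
    (hS : ∀ k ∉ S, M.row k = 0) : Fintype.card ι ≤ S.card := by
  classical
  have := Fintype.ofFinite κ
  have hspan : Submodule.span K (Set.range M.row) ≤ Submodule.span K (S.image M.row) := by
    rw [Submodule.span_le]
    rintro _ ⟨k, rfl⟩
    by_cases hk : k ∈ S
    · exact Submodule.subset_span (Finset.mem_coe.2 (Finset.mem_image_of_mem _ hk))
    · exact hS k hk ▸ zero_mem (Submodule.span K (S.image M.row : Set (ι → K)))
  calc
    Fintype.card ι = M.rank := by rw [← rank_transpose, LinearIndependent.rank_matrix (M := Mᵀ) hM]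
    _ = (Set.range M.row).finrank K := M.rank_eq_finrank_span_row
    _ ≤ (S.image M.row : Set (ι → K)).finrank K := Submodule.finrank_mono hspan
    _ ≤ S.card := (finrank_span_finset_le_card _).trans Finset.card_image_le

end Farkas

section IncidenceMatrix

variable {V : Type*} [DecidableEq V] {G : SimpleGraph V}

/-- The alternating sum of the edges of a walk, as a vector of edge coefficients, with sign `+` on
the first edge: in the incidence matrix it telescopes to a vector supported on the ends. -/
def alternatingVec : ∀ {u v : V}, G.Walk u v → G.edgeSet → ℤ
  | _, _, .nil => 0
  | u, _, .cons (v := w) h p => Pi.single ⟨s(u, w), h⟩ 1 - alternatingVec p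

theorem alternatingVec_apply_eq_zero {u v : V} {p : G.Walk u v} {e : G.edgeSet}
    (he : ↑e ∉ p.edges) : alternatingVec p e = 0 := by
  induction p with
  | nil => rfl
  | cons h p ih =>
    rw [Walk.edges_cons, List.mem_cons, not_or] at he
    simp [alternatingVec, ih he.2, Subtype.ext_iff, he.1]

variable [DecidableRel G.Adj]

theorem edgeIncMatrix_apply (v : V) (e : G.edgeSet) :
    G.edgeIncMatrix v e = if v ∈ (e : Sym2 V) then 1 else 0 := by
  simp [edgeIncMatrix, incMatrix_apply', incidenceSet]

theorem edgeIncMatrix_apply_of_notMem_support {v : V} (hv : v ∉ G.support) (e : G.edgeSet) :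
    G.edgeIncMatrix v e = 0 := by
  rw [edgeIncMatrix_apply, if_neg]
  intro hve
  obtain ⟨w, hw⟩ := hve
  exact hv (G.mem_support.2 ⟨w, by simpa [hw] using e.2⟩)

theorem col_edgeIncMatrix {u v : V} (h : G.Adj u v) :
    G.edgeIncMatrix.col ⟨s(u, v), h⟩ = Pi.single u 1 + Pi.single v 1 := by
  ext w
  have := h.ne
  by_cases hu : w = u <;> by_cases hv : w = v <;> simp_all [Matrix.col, edgeIncMatrix_apply]

theorem even_sum_edgeIncMatrix_mulVec [Fintype G.edgeSet] {f : G.edgeSet → ℤ} {S : Finset V}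
    (hS : ∀ u v (h : G.Adj u v), f ⟨s(u, v), h⟩ ≠ 0 → (u ∈ S ↔ v ∈ S)) :
    Even (∑ v ∈ S, (G.edgeIncMatrix *ᵥ f) v) := by
  simp only [mulVec_eq_sum_smul_col, Finset.sum_apply]
  rw [Finset.sum_comm]
  refine Finset.even_sum _ fun ⟨e, he⟩ _ => ?_
  induction e with | h u v =>
  by_cases hf : f ⟨s(u, v), he⟩ = 0
  · simp [hf]
  · by_cases hv : v ∈ S <;>
      simp [col_edgeIncMatrix (G.mem_edgeSet.1 he), ← Finset.mul_sum, Finset.sum_add_distrib,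
        hS u v he hf, hv]

theorem even_ncard_reachable_of_mulVec_eq_indicator [Finite V] [Fintype G.edgeSet]
    {f : G.edgeSet → ℤ} {S : Set V} (hf : G.edgeIncMatrix *ᵥ f = S.indicator 1) (s : V) :
    Even {v ∈ S | G.Reachable s v}.ncard := by
  classical
  have := Fintype.ofFinite V
  have heven : Even (∑ v with G.Reachable s v, (G.edgeIncMatrix *ᵥ f) v) := by
    refine even_sum_edgeIncMatrix_mulVec fun u v huv _ => ?_
    simp only [Finset.mem_filter, Finset.mem_univ, true_and]
    exact ⟨fun h => h.trans huv.reachable, fun h => h.trans huv.symm.reachable⟩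
  have hcard : ∑ v with G.Reachable s v, (G.edgeIncMatrix *ᵥ f) v =
      {v ∈ S | G.Reachable s v}.ncard := by
    simp [hf, Set.indicator_apply, Set.ncard_eq_toFinset_card', Finset.filter_filter, and_comm]
  exact_mod_cast hcard ▸ heven

theorem edgeIncMatrix_mulVec_alternatingVec [Fintype G.edgeSet] {u v : V} (p : G.Walk u v) :
    G.edgeIncMatrix *ᵥ alternatingVec p = Pi.single u 1 - (-1) ^ p.length • Pi.single v 1 := by
  induction p with
  | nil => simp [alternatingVec]
  | cons h p ih =>
    rw [alternatingVec, mulVec_sub, ih, mulVec_single_one, col_edgeIncMatrix h, Walk.length_cons,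
      pow_succ]
    simp only [mul_neg, mul_one, neg_smul]
    abel

theorem odd_length_of_linearIndependent_col {R : Type*} [CommRing R] [Nontrivial R]
    [Finite G.edgeSet] (hG : LinearIndependent R (G.edgeIncMatrix.map (Int.cast : ℤ → R)).col)
    {v : V} {c : G.Walk v v} (hc : c.IsCircuit) : Odd c.length := by
  have := Fintype.ofFinite G.edgeSet
  by_contra heven
  rw [Nat.not_odd_iff_even] at heven
  have hker : G.edgeIncMatrix.map (Int.cast : ℤ → R) *ᵥ (fun e => (alternatingVec c e : R)) =
      G.edgeIncMatrix.map (Int.cast : ℤ → R) *ᵥ 0 := by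
    ext
    simp [map_intCast_mulVec, edgeIncMatrix_mulVec_alternatingVec, heven.neg_one_pow]
  have hzero := mulVec_injective_iff.2 hG hker
  cases c with
  | nil => exact hc.ne_nil rfl
  | @cons _ w _ h p =>
    have hp : alternatingVec p ⟨s(v, w), h⟩ = 0 :=
      alternatingVec_apply_eq_zero ((Walk.isTrail_cons h p).1 hc.isTrail).2
    simpa [alternatingVec, hp] using congrFun hzero ⟨s(v, w), h⟩

theorem edgeIncMatrix_mulVec_half_alternatingVec_eq_zero {K : Type*} [Field K] [NeZero (2 : K)]
    [Fintype G.edgeSet] {s t : V} {c : G.Walk s s} (hc : Odd c.length) {d : G.Walk t t}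
    (hd : Odd d.length) (p : G.Walk s t) :
    G.edgeIncMatrix.map (Int.cast : ℤ → K) *ᵥ (fun e => 1 / 2 * (alternatingVec c e : K) -
      (-1) ^ p.length / 2 * (alternatingVec d e : K) - (alternatingVec p e : K)) = 0 := by
  have htwo : (2 : K) ≠ 0 := two_ne_zero
  have hcombination : (fun e => 1 / 2 * (alternatingVec c e : K) -
      (-1) ^ p.length / 2 * (alternatingVec d e : K) - (alternatingVec p e : K)) =
        (1 / 2 : K) • (fun e => (alternatingVec c e : K)) -
          ((-1) ^ p.length / 2 : K) • (fun e => (alternatingVec d e : K)) -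
            fun e => (alternatingVec p e : K) := rfl
  ext v
  simp only [hcombination, mulVec_sub, mulVec_smul, map_intCast_mulVec,
    edgeIncMatrix_mulVec_alternatingVec, hc.neg_one_pow, hd.neg_one_pow, Pi.sub_apply,
    Pi.smul_apply, smul_eq_mul, Pi.zero_apply]
  push_cast
  field_simp
  ring

theorem not_isFarkas_of_hasPathConnectedOddCycles [Fintype G.edgeSet]
    (hG : G.HasPathConnectedOddCycles) : ¬ G.edgeIncMatrix.IsFarkas := by
  obtain ⟨s, t, c, d, p, -, hc, -, hd, hcd, -⟩ := hG
  rw [isFarkas_iff_forall_mulVec_eq_zero]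
  intro h
  obtain ⟨y, hy, hAy⟩ := h _ (edgeIncMatrix_mulVec_half_alternatingVec_eq_zero hc hd p)
  simp only [Int.floor_sub_intCast, Int.ceil_sub_intCast, sub_le_iff_le_add, le_sub_iff_add_le]
    at hy
  have hsupport (e : G.edgeSet) (he : (y + alternatingVec p) e ≠ 0) :
      ↑e ∈ c.edges ∨ ↑e ∈ d.edges := by
    by_contra! hne
    have hye := hy e
    simp only [alternatingVec_apply_eq_zero hne.1, alternatingVec_apply_eq_zero hne.2,
      Int.cast_zero, mul_zero, sub_zero, Int.floor_zero, Int.ceil_zero] at hye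
    exact he (hye.2.antisymm hye.1)
  have heven : Even (∑ v ∈ c.support.toFinset,
      (G.edgeIncMatrix *ᵥ (y + alternatingVec p)) v) := by
    refine even_sum_edgeIncMatrix_mulVec fun u v huv hne => ?_
    simp only [List.mem_toFinset]
    rcases hsupport _ hne with he | he
    · exact iff_of_true (c.fst_mem_support_of_mem_edges he) (c.snd_mem_support_of_mem_edges he)
    · exact iff_of_false (fun h => hcd h (d.fst_mem_support_of_mem_edges he))
        (fun h => hcd h (d.snd_mem_support_of_mem_edges he))
  have ht : t ∉ c.support := fun ht => hcd ht d.start_mem_support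
  simp [mulVec_add, hAy, edgeIncMatrix_mulVec_alternatingVec, Finset.sum_sub_distrib,
    ← Finset.mul_sum, ht] at heven

end IncidenceMatrix

section Degree

variable {V : Type*} [Fintype V] [DecidableEq V] {G : SimpleGraph V} [DecidableRel G.Adj]
variable {K : Type*} [Field K]

theorem degree_eq_two_of_linearIndependent_col
    (hG : LinearIndependent K (G.edgeIncMatrix.map (Int.cast : ℤ → K)).col)
    (hdeg : ∀ v ∈ G.support, 2 ≤ G.degree v) : ∀ v ∈ G.support, G.degree v = 2 := by
  classical
  have hcard : G.edgeFinset.card ≤ G.support.toFinset.card := by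
    rw [edgeFinset, Set.toFinset_card]
    refine card_le_card_of_linearIndependent_col hG fun v hv => funext fun e => ?_
    rw [Set.mem_toFinset] at hv
    simp [edgeIncMatrix_apply_of_notMem_support hv]
  have hsum : ∑ v ∈ G.support, G.degree v ≤ ∑ v ∈ G.support, 2 := by
    rw [G.sum_degrees_support_eq_twice_card_edges, Finset.sum_const, smul_eq_mul]
    omega
  have hdeg' : ∀ v ∈ G.support.toFinset, 2 ≤ G.degree v := by simpa using hdeg
  have heq := (Finset.sum_eq_sum_iff_of_le hdeg').1 ((Finset.sum_le_sum hdeg').antisymm hsum)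
  simpa [eq_comm] using heq

theorem card_filter_mem_edgeSet (v : V) :
    (Finset.univ.filter fun e : G.edgeSet => v ∈ (e : Sym2 V)).card = G.degree v := by
  rw [← card_incidenceFinset_eq_degree, ← Finset.card_map (Function.Embedding.subtype _)]
  congr 1
  ext e
  simp [incidenceSet, and_comm]

variable [LinearOrder K] [IsStrictOrderedRing K]

theorem edgeIncMatrix_mulVec_pos_and_lt_degree {g : G.edgeSet → K}
    (hg : ∀ e, 0 < g e ∧ g e < 1) {v : V} (hv : v ∈ G.support) :
    0 < (G.edgeIncMatrix.map (Int.cast : ℤ → K) *ᵥ g) v ∧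
      (G.edgeIncMatrix.map (Int.cast : ℤ → K) *ᵥ g) v < G.degree v := by
  let E : Finset G.edgeSet := Finset.univ.filter fun e => v ∈ (e : Sym2 V)
  have hsum : (G.edgeIncMatrix.map (Int.cast : ℤ → K) *ᵥ g) v = ∑ e ∈ E, g e := by
    simp [E, mulVec, dotProduct, edgeIncMatrix_apply, Finset.sum_filter]
  obtain ⟨w, hw⟩ := hv
  have hE : E.Nonempty := ⟨⟨s(v, w), hw⟩, by simp [E]⟩
  rw [hsum, ← card_filter_mem_edgeSet]
  exact ⟨Finset.sum_pos (fun e _ => (hg e).1) hE,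
    by simpa using Finset.sum_lt_sum_of_nonempty hE fun e _ => (hg e).2⟩

theorem isCycles_and_eq_indicator_of_linearIndependent_col
    (hG : LinearIndependent K (G.edgeIncMatrix.map (Int.cast : ℤ → K)).col)
    {g : G.edgeSet → K} (hg : ∀ e, 0 < g e ∧ g e < 1) {z : V → ℤ}
    (hz : G.edgeIncMatrix.map (Int.cast : ℤ → K) *ᵥ g = fun v => (z v : K)) :
    G.IsCycles ∧ z = G.support.indicator 1 := by
  classical
  have hz_bounds (v : V) (hv : v ∈ G.support) : 0 < z v ∧ z v < G.degree v := by
    have h := edgeIncMatrix_mulVec_pos_and_lt_degree hg hv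
    simp only [hz] at h
    exact_mod_cast h
  have hdeg : ∀ v ∈ G.support, G.degree v = 2 :=
    degree_eq_two_of_linearIndependent_col hG fun v hv => by
      have := hz_bounds v hv
      omega
  refine ⟨fun v hv => ?_, funext fun v => ?_⟩
  · rw [Set.ncard_eq_toFinset_card', ← neighborFinset_def, card_neighborFinset_eq_degree]
    exact hdeg v hv
  by_cases hv : v ∈ G.support
  · have := hz_bounds v hv
    have := hdeg v hv
    rw [Set.indicator_of_mem hv, Pi.one_apply]
    omega
  · have hzv := congrFun hz v
    simp only [mulVec, dotProduct, map_apply, edgeIncMatrix_apply_of_notMem_support hv,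
      Int.cast_zero, zero_mul, Finset.sum_const_zero] at hzv
    rw [Set.indicator_of_notMem hv]
    exact_mod_cast hzv.symm

end Degree

section OddCycles

variable {V : Type*} {F G : SimpleGraph V}

theorem card_toFinset_support_of_isCycle [DecidableEq V] {v : V} {c : G.Walk v v}
    (hc : c.IsCycle) : c.support.toFinset.card = c.length := by
  have htail : c.support.toFinset = c.support.tail.toFinset := by
    rw [← c.cons_tail_support, List.toFinset_cons, List.tail_cons, Finset.insert_eq_self,
      List.mem_toFinset]
    exact c.end_mem_tail_support hc.not_nil
  rw [htail, List.toFinset_card_of_nodup hc.support_nodup, List.length_tail, Walk.length_support,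
    Nat.add_sub_cancel]

theorem hasPathConnectedOddCycles_of_isCycles [Finite V] (hFG : F ≤ G) (hF : F.IsCycles)
    (hodd : ∀ v (c : F.Walk v v), c.IsCycle → Odd c.length) {s : V} (hs : s ∈ F.support)
    (heven : Even {v ∈ F.support | G.Reachable s v}.ncard) : G.HasPathConnectedOddCycles := by
  classical
  have hcycle (v) (hv : v ∈ F.support) :
      ∃ c : F.Walk v v, c.IsCycle ∧ ∀ w, w ∈ c.support ↔ F.Reachable w v := by
    obtain ⟨c, hc, hverts⟩ := hF.exists_cycle_toSubgraph_verts_eq_connectedComponentSupp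
      (c := F.connectedComponentMk v) rfl hv
    refine ⟨c, hc, fun w => ?_⟩
    rw [← Walk.mem_verts_toSubgraph, hverts, ConnectedComponent.mem_supp_iff, ConnectedComponent.eq]
  obtain ⟨c, hc, hc_mem⟩ := hcycle s hs
  obtain ⟨t, ⟨ht, hst⟩, htc⟩ : ∃ t ∈ {v ∈ F.support | G.Reachable s v}, t ∉ c.support := by
    by_contra! hall
    have heq : {v ∈ F.support | G.Reachable s v} = c.support.toFinset := by
      ext v
      rw [Finset.mem_coe, List.mem_toFinset]
      refine ⟨hall v, fun hv => ⟨?_, (((hc_mem v).1 hv).mono hFG).symm⟩⟩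
      obtain rfl | hne := eq_or_ne v s
      exacts [hs, mem_support_of_reachable hne ((hc_mem v).1 hv)]
    rw [heq, Set.ncard_coe_finset, card_toFinset_support_of_isCycle hc] at heven
    exact Nat.not_even_iff_odd.2 (hodd s c hc) heven
  obtain ⟨d, hd, hd_mem⟩ := hcycle t ht
  obtain ⟨p, hp⟩ := hst.exists_isPath
  refine ⟨s, t, c.mapLe hFG, d.mapLe hFG, p, hc.mapLe hFG, by simpa using hodd s c hc,
    hd.mapLe hFG, by simpa using hodd t d hd, ?_, hp⟩
  simp only [Walk.support_mapLe_eq_support]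
  intro w hwc hwd
  exact htc ((hc_mem t).2 (((hd_mem w).1 hwd).symm.trans ((hc_mem w).1 hwc)))

end OddCycles

section FractGraph

variable {V K : Type*} {G : SimpleGraph V} [Ring K] [LinearOrder K] [FloorRing K]

/-- The spanning subgraph of `G` formed by the edges at which `x` is not an integer. -/
def fractGraph (x : G.edgeSet → K) : SimpleGraph V where
  Adj u v := ∃ h : G.Adj u v, Int.fract (x ⟨s(u, v), h⟩) ≠ 0
  symm := ⟨fun _ _ ⟨h, hx⟩ => ⟨h.symm, by simpa only [Sym2.eq_swap] using hx⟩⟩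
  loopless := ⟨fun _ ⟨h, _⟩ => h.ne rfl⟩

namespace fractGraph

instance [DecidableRel G.Adj] (x : G.edgeSet → K) : DecidableRel (fractGraph x).Adj :=
  fun _ _ => inferInstanceAs (Decidable (∃ _, _))

theorem mem_edgeSet {x : G.edgeSet → K} {e : Sym2 V} :
    e ∈ (fractGraph x).edgeSet ↔ ∃ h : e ∈ G.edgeSet, Int.fract (x ⟨e, h⟩) ≠ 0 := by
  induction e with | h u v => rfl

theorem le (x : G.edgeSet → K) : fractGraph x ≤ G := fun _ _ h => h.1

/-- The inclusion of the edges at which `x` is not an integer into all edges. -/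
def inclusion (x : G.edgeSet → K) : (fractGraph x).edgeSet → G.edgeSet :=
  Set.inclusion (edgeSet_mono (le x))

theorem inclusion_injective (x : G.edgeSet → K) : Function.Injective (inclusion x) :=
  Set.inclusion_injective (edgeSet_mono (le x))

theorem fract_inclusion_ne_zero {x : G.edgeSet → K} (e : (fractGraph x).edgeSet) :
    Int.fract (x (inclusion x e)) ≠ 0 :=
  (mem_edgeSet.1 e.2).2

variable [DecidableEq V] [DecidableRel G.Adj]

theorem edgeIncMatrix_inclusion (x : G.edgeSet → K) (v : V) (e : (fractGraph x).edgeSet) :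
    G.edgeIncMatrix v (inclusion x e) = (fractGraph x).edgeIncMatrix v e := by
  simp [edgeIncMatrix_apply, inclusion]

theorem linearIndependent_col {x : G.edgeSet → K}
    (hx : LinearIndepOn K (G.edgeIncMatrix.map (Int.cast : ℤ → K)).col
      {e | Int.fract (x e) ≠ 0}) :
    LinearIndependent K ((fractGraph x).edgeIncMatrix.map (Int.cast : ℤ → K)).col := by
  have hcomp := hx.comp (fun e => ⟨inclusion x e, fract_inclusion_ne_zero e⟩)
    fun _ _ h => inclusion_injective x (Subtype.ext_iff.1 h)
  convert! hcomp using 1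
  ext e v
  simp [edgeIncMatrix_inclusion]

theorem edgeIncMatrix_mulVec_fract [Fintype G.edgeSet] (x : G.edgeSet → K)
    [Fintype (fractGraph x).edgeSet] :
    (fractGraph x).edgeIncMatrix.map (Int.cast : ℤ → K) *ᵥ
        (fun e => Int.fract (x (inclusion x e))) =
      G.edgeIncMatrix.map (Int.cast : ℤ → K) *ᵥ fun e => Int.fract (x e) := by
  ext v
  refine Fintype.sum_of_injective _ (inclusion_injective x) _ _ (fun e he => ?_) fun e => ?_
  · have hfract : Int.fract (x e) = 0 := by
      by_contra h
      exact he ⟨⟨e, mem_edgeSet.2 ⟨e.2, h⟩⟩, rfl⟩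
    simp [hfract]
  · simp [edgeIncMatrix_inclusion]

end fractGraph

end FractGraph

theorem hasPathConnectedOddCycles_of_exists_fract_ne_zero {V K : Type*} [Fintype V]
    [DecidableEq V] {G : SimpleGraph V} [DecidableRel G.Adj] [Field K] [LinearOrder K]
    [IsStrictOrderedRing K] [FloorRing K] {x : G.edgeSet → K}
    (hx : G.edgeIncMatrix.map (Int.cast : ℤ → K) *ᵥ x = 0)
    (hindep : LinearIndepOn K (G.edgeIncMatrix.map (Int.cast : ℤ → K)).col
      {e | Int.fract (x e) ≠ 0})
    (hfract : ∃ e, Int.fract (x e) ≠ 0) : G.HasPathConnectedOddCycles := by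
  obtain ⟨⟨e, he⟩, hxe⟩ := hfract
  induction e with | h s r =>
  let z : V → ℤ := G.edgeIncMatrix *ᵥ fun e => -⌊x e⌋
  have hz : (fractGraph x).edgeIncMatrix.map (Int.cast : ℤ → K) *ᵥ
      (fun e => Int.fract (x (fractGraph.inclusion x e))) = fun v => (z v : K) := by
    have hfract_eq : (fun e => Int.fract (x e)) = x + fun e => ((-⌊x e⌋ : ℤ) : K) := by
      ext e
      simp [Int.fract, sub_eq_add_neg]
    rw [fractGraph.edgeIncMatrix_mulVec_fract, hfract_eq, mulVec_add, hx, zero_add,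
      map_intCast_mulVec]
  have hF := fractGraph.linearIndependent_col hindep
  obtain ⟨hcycles, hindicator⟩ := isCycles_and_eq_indicator_of_linearIndependent_col hF (fun e =>
    ⟨(Int.fract_nonneg _).lt_of_ne' (fractGraph.fract_inclusion_ne_zero e), Int.fract_lt_one _⟩) hz
  exact hasPathConnectedOddCycles_of_isCycles (fractGraph.le x) hcycles
    (fun _ _ hc => odd_length_of_linearIndependent_col hF hc.isCircuit) (s := s) ⟨r, he, hxe⟩
    (even_ncard_reachable_of_mulVec_eq_indicator hindicator s)

theorem proposition4p2 {V : Type*} [Fintype V] [DecidableEq V] (G : SimpleGraph V)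
    [DecidableRel G.Adj] :
    G.edgeIncMatrix.IsFarkas ↔ ¬ G.HasPathConnectedOddCycles :=
  ⟨fun h hG => not_isFarkas_of_hasPathConnectedOddCycles hG h, fun hG =>
    isFarkas_of_forall_linearIndepOn fun _ hx hindep => by
      by_contra! hfract
      exact hG (hasPathConnectedOddCycles_of_exists_fract_ne_zero hx hindep hfract)⟩
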